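/- Let $G$ be a finite group, $\mathrm{Irr}(G)$ its set of irreducible complex characters, $C_g$ the conjugacy class of $g\in G$, and for $\chi\in\mathrm{Irr}(G)$ let $e_\chi=|G|^{-1}\chi(1)\sum_{g\in G}\chi(g^{-1})g\in\mathbb C[G]$ be the corresponding central idempotent. For $g\in G$ put $$E_g=\Big\{e_\chi:\chi\in\mathrm{Irr}(G),\ 1-\tfrac{\chi(g)}{\chi(1)}\neq0\Big\},\qquad K_g=\bigcup_{h\in G,\;E_h=E_g}C_h .$$ Let $N(G)$ be the set of all normal subgroups of $G$. For $A\subseteq N(G)$ and $N\in A$ put $N^\circ_A=N\setminus\bigcup_{H\in A,\,H\subsetneq N}H$, and write $N^\circ=N^\circ_{N(G)}$. For $S\subseteq N(G)$ let $A(S)$ be the smallest subset of $N(G)$ that contains $S$, $\{1\}$ and $G$ and is closed under products and intersections; the normal supercharacter theory generated by $S$ is the one whose superclasses are the nonempty sets among the $N^\circ_{A(S)}$, $N\in A(S)$. A supercharacter theory of $G$ is a pair $(\mathcal X,\mathcal K)$ of a partition $\mathcal X$ of $\mathrm{Irr}(G)$ and a partition $\mathcal K$ of $G$ such that $|\mathcal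 X|=|\mathcal K|$, $\{1\}\in\mathcal K$, and for each $X\in\mathcal X$ there is a nonzero character, all of whose irreducible constituents lie in $X$, that is constant on every part of $\mathcal K$; the parts of $\mathcal K$ are its superclasses. A superclass theory is a partition $\mathcal K$ of $G$ that is the set of superclasses of some supercharacter theory; equivalently, $\{1\}\in\mathcal K$ and the $\mathbb C$-span of the elements $\sum_{g\in K}g$, $K\in\mathcal K$, is a subring of the center of $\mathbb C[G]$. Then: 1. $\{K_g:g\in G\}=\{N^\circ:N\in N(G),\ N^\circ\neq\emptyset\}$, and these sets are the superclasses generated by $S=N(G)$. 2. This partition of $G$ is a superclass theory (both equivalent conditions hold). 3. It is the finest normal one: for every $S\subseteq N(G)$, each $K_g$ is contained in some nonempty $N^\circ_{A(S)}$ with $N\in A(S)$. 4. It is determined by the vanishing of the values $1-\chi(g)/\chi(1)$: for $g,h\in G$, $h\in K_g$ if and only if, for every $\chi\in\mathrm{Irr}(G)$, $1-\chi(h)/\chi(1)\ne0\iff 1-\chi(g)/\chi(1)\neq0$. -/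

import Mathlib

noncomputable section

namespace NormalSCT

/-- The set `Irr(G)` of irreducible complex characters of `G`. Every finite-dimensional complex
representation is isomorphic to one on some `ℂⁿ`, so it is enough to take those. -/
def Irr (G : Type*) [Group G] : Set (G → ℂ) :=
  {χ | ∃ (n : ℕ) (ρ : Representation ℂ G (Fin n → ℂ)), ρ.IsIrreducible ∧ χ = ρ.character}

/-- The central idempotent `e_χ = |G|⁻¹ χ(1) ∑_g χ(g⁻¹) g` of the group algebra `ℂ[G]`. -/
def centralIdem {G : Type*} [Group G] [Fintype G] (χ : G → ℂ) : MonoidAlgebra ℂ G :=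
  ((Fintype.card G : ℂ)⁻¹ * χ 1) • ∑ g : G, MonoidAlgebra.single g (χ g⁻¹)

/-- `E_g = {e_χ : χ ∈ Irr(G), 1 - χ(g)/χ(1) ≠ 0}`. -/
def E {G : Type*} [Group G] [Fintype G] (g : G) : Set (MonoidAlgebra ℂ G) :=
  {e | ∃ χ ∈ Irr G, 1 - χ g / χ 1 ≠ 0 ∧ e = centralIdem χ}

/-- `K_g` is the union of the conjugacy classes `C_h` over all `h` with `E_g = E_h`. -/
def K {G : Type*} [Group G] [Fintype G] (g : G) : Set G :=
  ⋃ (h : G) (_ : E g = E h), conjugatesOf h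

/-- `N(G)`: the set of all normal subgroups of `G`. -/
def normalSubgroups (G : Type*) [Group G] : Set (Subgroup G) :=
  {N | N.Normal}

/-- The smallest collection of subgroups that contains `S`, the trivial subgroup and `G` and is
closed under product and intersection. It is used for sets `S` of normal subgroups only, and for
normal subgroups the product `H * K` is the join `H ⊔ K`. -/
inductive Generated {G : Type*} [Group G] (S : Set (Subgroup G)) : Subgroup G → Prop
  | basic (N : Subgroup G) : N ∈ S → Generated S N
  | bot : Generated S ⊥
  | top : Generated S ⊤
  | mul (H K : Subgroup G) : Generated S H → Generated S K → Generated S (H ⊔ K)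
  | inter (H K : Subgroup G) : Generated S H → Generated S K → Generated S (H ⊓ K)

/-- `N°` relative to a collection `A` of subgroups: the elements of `N` that lie in no member
of `A` properly contained in `N`. -/
def circ {G : Type*} [Group G] (A : Set (Subgroup G)) (N : Subgroup G) : Set G :=
  (N : Set G) \ ⋃ (H : Subgroup G) (_ : H ∈ A) (_ : H < N), (H : Set G)

/-- The nonempty sets among the `N°`, for `N` in the collection `A`. -/
def circParts {G : Type*} [Group G] (A : Set (Subgroup G)) : Set (Set G) :=
  {P | P.Nonempty ∧ ∃ N ∈ A, P = circ A N}

/-- `𝒦` has the form of the superclasses of a normal supercharacter theory: it consists of the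
nonempty `N°`, where `N` runs through the collection generated by a set of normal subgroups.
(That `𝒦` is a superclass theory is not part of this definition, so comparing with all such `𝒦`
covers all normal supercharacter theories.) -/
def IsNormalTheory {G : Type*} [Group G] (𝒦 : Set (Set G)) : Prop :=
  ∃ S : Set (Subgroup G), S ⊆ normalSubgroups G ∧ 𝒦 = circParts {N | Generated S N}

/-- The character `∑ m(χ) χ` with multiplicities `m`. Its irreducible constituents are the `χ`
with `m(χ) ≠ 0`. -/
def charOfMult {G : Type*} [Group G] (m : Irr G →₀ ℕ) : G → ℂ :=
  fun g => m.sum fun χ k => (k : ℂ) * (χ : G → ℂ) g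

/-- Supercharacter theories `(𝒳, 𝒦)` in the sense of Diaconis and Isaacs. -/
structure IsSupercharacterTheory {G : Type*} [Group G]
    (𝒳 : Set (Set (Irr G))) (𝒦 : Set (Set G)) : Prop where
  partition_irr : Setoid.IsPartition 𝒳
  partition_group : Setoid.IsPartition 𝒦
  card_eq : 𝒦.encard = 𝒳.encard
  /-- Each `X ∈ 𝒳` has a nonzero character with all irreducible constituents in `X` that is
  constant on every part of `𝒦`. -/
  supercharacter : ∀ X ∈ 𝒳, ∃ m : Irr G →₀ ℕ, m ≠ 0 ∧ (m.support : Set (Irr G)) ⊆ X ∧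
    ∀ P ∈ 𝒦, ∀ a ∈ P, ∀ b ∈ P, charOfMult m a = charOfMult m b
  singleton_one : {1} ∈ 𝒦

/-- The sum of the elements of `P` in the group algebra. -/
def setSum {G : Type*} [Group G] [Fintype G] (P : Set G) : MonoidAlgebra ℂ G :=
  ∑ g ∈ P.toFinite.toFinset, MonoidAlgebra.single g 1

/-- Superclass theories of `G`: partitions of `G` that satisfy the following two conditions, which
are well known to be equivalent: `𝒦` is the set of superclasses of a supercharacter theory;
`{1} ∈ 𝒦` and the span of the sums of the parts of `𝒦` is a subring of the center of `ℂ[G]`.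
Both are asked for here, so that nothing depends on that equivalence. -/
structure IsSuperclassTheory {G : Type*} [Group G] [Fintype G] (𝒦 : Set (Set G)) : Prop where
  partition : Setoid.IsPartition 𝒦
  superclasses : ∃ 𝒳 : Set (Set (Irr G)), IsSupercharacterTheory 𝒳 𝒦
  singleton_one : {1} ∈ 𝒦
  subring : ∃ R : Subring (MonoidAlgebra ℂ G), R ≤ Subring.center (MonoidAlgebra ℂ G) ∧
    (R : Set (MonoidAlgebra ℂ G)) = Submodule.span ℂ (setSum '' 𝒦)

/-- `𝒦` is finer than (or equal to) `𝒦'`. -/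
def Refines {G : Type*} (𝒦 𝒦' : Set (Set G)) : Prop :=
  ∀ P ∈ 𝒦, ∃ Q ∈ 𝒦', P ⊆ Q

end NormalSCT

end

noncomputable section

namespace NormalSCT

open Module Polynomial

/-! Everything is expressed through the normal closure map `ncl`. Since `χ g = χ 1` holds exactly
when `g` lies in the kernel of `χ`, the set `E g` records which kernels miss `g`. Every normal
subgroup is an intersection of such kernels (`exists_le_charKer_notMem`), so `E g` determines `ncl
g` and conversely. Hence both the `K g` and the nonempty `N°` are the fibres of `ncl`.

The fibres form a superclass theory because of the permutation character of `G ⧸ N`: it is a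
multiple of the indicator of `N`, and it equals the sum of `χ(1)χ` over all `χ` with `N ≤ ker χ`.
Grouping the `χ` by exact kernel and inverting triangular systems over the lattice of normal
subgroups, the grouped sums, the indicators of normal subgroups and the indicators of fibres all
span one space. So the grouped sums are constant on fibres, and counting its dimension twice gives
equally many parts on both sides. The subring condition follows because the sums over `N` and `M`
multiply to a multiple of the sum over `N ⊔ M`. -/

/-! ### Irreducible characters and their kernels -/

theorem eq_one_of_trace_eq_finrank {V : Type*} [AddCommGroup V] [Module ℂ V]
    [FiniteDimensional ℂ V] {f : Module.End ℂ V} {k : ℕ} (hk : k ≠ 0) (hf : f ^ k = 1)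
    (htr : LinearMap.trace ℂ V f = finrank ℂ V) : f = 1 := by
  have hsplits : f.charpoly.Splits := IsAlgClosed.splits _
  have hroot : ∀ r ∈ f.charpoly.roots, ‖r‖ = 1 := by
    intro r hr
    have hr' := (Module.End.hasEigenvalue_iff_isRoot_charpoly f r).2
      (isRoot_of_mem_roots hr)
    obtain ⟨v, hv⟩ := hr'.exists_hasEigenvector
    have h1 := hv.pow_apply k
    rw [hf, Module.End.one_apply] at h1
    have h2 : (r ^ k - 1) • v = 0 := by rw [sub_smul, one_smul, ← h1, sub_self]
    have h3 : r ^ k = 1 := by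
      rcases smul_eq_zero.1 h2 with h | h
      · exact sub_eq_zero.1 h
      · exact absurd h hv.2
    exact Complex.norm_eq_one_of_pow_eq_one h3 hk
  have hcard : f.charpoly.roots.card = finrank ℂ V := by
    rw [splits_iff_card_roots.1 hsplits, LinearMap.charpoly_natDegree]
  -- The eigenvalues lie on the unit circle, so these terms are nonnegative; a zero sum forces every
  -- eigenvalue to be 1.
  have hsum : (f.charpoly.roots.map fun r : ℂ => 1 - r.re).sum = 0 := by
    have h1 : (f.charpoly.roots.map Complex.re).sum = finrank ℂ V := by
      have h2 := Module.End.trace_eq_sum_roots_charpoly_of_splits hsplits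
      rw [htr] at h2
      have h3 := congrArg Complex.reAddGroupHom h2
      rw [map_multiset_sum] at h3
      simpa using h3.symm
    rw [Multiset.sum_map_sub, h1]
    simp [hcard]
  have hone : ∀ r ∈ f.charpoly.roots, r = 1 := by
    intro r hr
    have hle : ∀ x ∈ f.charpoly.roots.map fun r : ℂ => 1 - r.re, (0 : ℝ) ≤ x := by
      intro x hx
      obtain ⟨s, hs, rfl⟩ := Multiset.mem_map.1 hx
      have := Complex.re_le_norm s
      rw [hroot s hs] at this
      linarith
    have h1 := Multiset.single_le_sum hle _ (Multiset.mem_map_of_mem _ hr)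
    have h1' := hle _ (Multiset.mem_map_of_mem _ hr)
    have h2 : r.re = 1 := by linarith
    have h3 := hroot r hr
    have h4 := Complex.sq_norm r
    rw [h3, Complex.normSq_apply, h2] at h4
    apply Complex.ext
    · simpa using h2
    · simp only [Complex.one_im]
      nlinarith
  have hchar : f.charpoly = (X - 1) ^ finrank ℂ V := by
    rw [hsplits.eq_prod_roots_of_monic f.charpoly_monic, Multiset.eq_replicate_card.2 hone]
    simp [hcard]
  have hnil : IsNilpotent (f - 1) := by
    refine ⟨finrank ℂ V, ?_⟩
    have := f.aeval_self_charpoly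
    rw [hchar] at this
    simpa using this
  have hss : f.IsSemisimple := by
    refine Module.End.isSemisimple_of_squarefree_aeval_eq_zero (p := X ^ k - 1) ?_ (by simp [hf])
    exact (X_pow_sub_one_separable_iff.2 (by exact_mod_cast hk)).squarefree
  have hss' : (f - 1).IsSemisimple := by
    simpa using (Module.End.isSemisimple_sub_algebraMap_iff (f := f) (μ := (1 : ℂ))).2 hss
  exact sub_eq_zero.1 (Module.End.eq_zero_of_isNilpotent_isSemisimple hnil hss')

variable {G : Type*} [Group G]

theorem isIrreducible_of_equiv {V W : Type*} [AddCommGroup V] [Module ℂ V] [AddCommGroup W]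
    [Module ℂ W] {ρ : Representation ℂ G V} {σ : Representation ℂ G W}
    (e : Representation.Equiv ρ σ) (h : ρ.IsIrreducible) : σ.IsIrreducible := by
  rw [Representation.irreducible_iff_isSimpleModule_asModule] at h ⊢
  let f := Representation.IntertwiningMap.equivLinearMapAsModule ρ σ e.toIntertwiningMap
  have hf : Function.Bijective f := e.toLinearEquiv.bijective
  exact (LinearEquiv.ofBijective f hf).isSimpleModule_iff.1 h

theorem character_mem_Irr {V : Type*} [AddCommGroup V] [Module ℂ V] [FiniteDimensional ℂ V]
    {ρ : Representation ℂ G V} (h : ρ.IsIrreducible) : ρ.character ∈ Irr G := by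
  let e := (Module.finBasis ℂ V).equivFun
  let σ : Representation ℂ G (Fin (finrank ℂ V) → ℂ) :=
    (e.conjRingEquiv : Module.End ℂ V →* Module.End ℂ _).comp ρ
  have φ : Representation.Equiv ρ σ := .mk e fun g => by
    ext v i
    simp [σ]
  exact ⟨_, σ, isIrreducible_of_equiv φ h, Representation.char_iso φ⟩

theorem character_eq_add {V : Type*} [AddCommGroup V] [Module ℂ V] [FiniteDimensional ℂ V]
    {ρ : Representation ℂ G V} {p q : Subrepresentation ρ} (h : IsCompl p q) :
    ρ.character = p.toRepresentation.character + q.toRepresentation.character := by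
  have h' : IsCompl p.toSubmodule q.toSubmodule := by
    rw [isCompl_iff, disjoint_iff, codisjoint_iff] at h ⊢
    exact ⟨congrArg Subrepresentation.toSubmodule h.1, congrArg Subrepresentation.toSubmodule h.2⟩
  ext g
  let e := Submodule.prodEquivOfIsCompl _ _ h'
  have : ρ g = e.conj ((p.toRepresentation g).prodMap (q.toRepresentation g)) := by
    ext v
    obtain ⟨w, rfl⟩ := e.surjective v
    simp [LinearEquiv.conj_apply, e, Subrepresentation.toRepresentation]
  simp only [Representation.character, Pi.add_apply]
  rw [this, LinearMap.trace_conj', LinearMap.trace_prodMap']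

theorem character_mem_span_Irr [Finite G] {V : Type*} [AddCommGroup V] [Module ℂ V]
    [FiniteDimensional ℂ V] (ρ : Representation ℂ G V) :
    ρ.character ∈ Submodule.span ℂ (Irr G) := by
  induction hn : finrank ℂ V using Nat.strong_induction_on generalizing V with
  | _ n ih =>
  by_cases hirr : ρ.IsIrreducible
  · exact Submodule.subset_span (character_mem_Irr hirr)
  rcases subsingleton_or_nontrivial V with hV | hV
  · have : ρ.character = 0 := by
      ext g
      rw [Representation.character, Subsingleton.elim (ρ g) 0]
      simp
    rw [this]
    exact zero_mem _
  have hnt : Nontrivial (Subrepresentation ρ) := by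
    refine ⟨⊥, ⊤, fun h => ?_⟩
    exact bot_ne_top (α := Submodule ℂ V) (congrArg Subrepresentation.toSubmodule h)
  obtain ⟨p, hp⟩ : ∃ p : Subrepresentation ρ, ¬(p = ⊥ ∨ p = ⊤) := by
    by_contra! hc
    exact hirr { toNontrivial := hnt, eq_bot_or_eq_top := hc }
  push Not at hp
  -- The hypothesis of Maschke's theorem, which supplies the invariant complement below.
  have : NeZero (Nat.card G : ℂ) := ⟨by exact_mod_cast Nat.card_pos.ne'⟩
  obtain ⟨q, hq⟩ := exists_isCompl p
  have hq1 : q ≠ ⊤ := fun h => hp.1 (by rw [h] at hq; exact eq_bot_of_isCompl_top hq)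
  have hlt : ∀ r : Subrepresentation ρ, r ≠ ⊤ → finrank ℂ r.toSubmodule < n := by
    intro r hr
    rw [← hn]
    refine Submodule.finrank_lt (lt_top_iff_ne_top.2 fun h => hr ?_).ne
    exact Subrepresentation.toSubmodule_injective h
  rw [character_eq_add hq]
  exact add_mem (ih _ (hlt p hp.2) _ rfl) (ih _ (hlt q hq1) _ rfl)

/-- The degree of an irreducible character. -/
def Irr.degree (χ : Irr G) : ℕ := χ.2.choose

/-- A representation affording the irreducible character `χ`. -/
def Irr.rep (χ : Irr G) : Representation ℂ G (Fin (Irr.degree χ) → ℂ) := χ.2.choose_spec.choose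

theorem Irr.rep_isIrreducible (χ : Irr G) : (Irr.rep χ).IsIrreducible :=
  χ.2.choose_spec.choose_spec.1

theorem Irr.character_rep (χ : Irr G) : (Irr.rep χ).character = χ :=
  χ.2.choose_spec.choose_spec.2.symm

theorem Irr.apply_one (χ : Irr G) : (χ : G → ℂ) 1 = Irr.degree χ := by
  rw [← Irr.character_rep χ, Representation.char_one]
  simp

theorem Irr.degree_ne_zero (χ : Irr G) : Irr.degree χ ≠ 0 := by
  intro h
  have := Irr.rep_isIrreducible χ
  obtain ⟨p, q, hpq⟩ := this.toNontrivial
  have : IsEmpty (Fin (Irr.degree χ)) := by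
    rw [h]
    infer_instance
  exact hpq (Subrepresentation.toSubmodule_injective (Subsingleton.elim _ _))

theorem Irr.apply_one_ne_zero (χ : Irr G) : (χ : G → ℂ) 1 ≠ 0 := by
  rw [Irr.apply_one]
  exact_mod_cast Irr.degree_ne_zero χ

/-- The kernel of an irreducible character. -/
def charKer (χ : Irr G) : Subgroup G := MonoidHom.ker (Irr.rep χ)

instance (χ : Irr G) : (charKer χ).Normal := MonoidHom.normal_ker _

theorem mem_charKer [Finite G] {χ : Irr G} {g : G} :
    g ∈ charKer χ ↔ (χ : G → ℂ) g = (χ : G → ℂ) 1 := by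
  rw [charKer, MonoidHom.mem_ker]
  have hχ := Irr.character_rep χ
  constructor
  · intro h
    simp [← hχ, Representation.character, h]
  · intro h
    refine eq_one_of_trace_eq_finrank (k := Nat.card G) Nat.card_pos.ne' ?_ ?_
    · rw [← map_pow, pow_card_eq_one', map_one]
    · rw [← hχ, Representation.char_one] at h
      exact h

/-! ### Orthogonality relations -/

section Orthogonality

variable [Fintype G]

/-- Pairing of functions on `G` with the inverse of `ψ`. -/
def charPairing (ψ : G → ℂ) : (G → ℂ) →ₗ[ℂ] ℂ where
  toFun f := (Nat.card G : ℂ)⁻¹ * ∑ g : G, f g * ψ g⁻¹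
  map_add' f g := by simp only [Pi.add_apply, add_mul, Finset.sum_add_distrib, mul_add]
  map_smul' c f := by
    simp only [Pi.smul_apply, smul_eq_mul, RingHom.id_apply, Finset.mul_sum]
    exact Finset.sum_congr rfl fun _ _ => by ring

open Classical in
theorem charPairing_Irr (χ ψ : Irr G) :
    charPairing (ψ : G → ℂ) (χ : G → ℂ) = if χ = ψ then 1 else 0 := by
  have := Irr.rep_isIrreducible χ
  have := Irr.rep_isIrreducible ψ
  have : Invertible (Nat.card G : ℂ) :=
    invertibleOfNonzero (by exact_mod_cast Nat.card_pos.ne')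
  have h := Representation.char_orthonormal (Irr.rep χ) (Irr.rep ψ)
  rw [Irr.character_rep, Irr.character_rep] at h
  rw [charPairing, LinearMap.coe_mk, AddHom.coe_mk, h]
  split_ifs with h1 h2 h2
  · simp
  · refine absurd (Subtype.ext ?_) h2
    rw [← Irr.character_rep χ, ← Irr.character_rep ψ]
    exact (Representation.char_iso h1.some).symm
  · subst h2
    exact absurd ⟨Representation.Equiv.refl _⟩ h1
  · simp

/-- Pairing a relation with `χ` isolates its coefficient. Finiteness of `Irr G` follows, as the
functions on `G` form a finite-dimensional space. -/
theorem linearIndependent_Irr : LinearIndependent ℂ (fun χ : Irr G => (χ : G → ℂ)) := by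
  classical
  rw [linearIndependent_iff']
  intro s a h χ hχ
  have := congrArg (charPairing (χ : G → ℂ)) h
  simpa [charPairing_Irr, hχ] using this

instance : Finite (Irr G) := linearIndependent_Irr.finite

instance : Fintype (Irr G) := Fintype.ofFinite _

theorem eq_sum_charPairing {f : G → ℂ} (hf : f ∈ Submodule.span ℂ (Irr G)) :
    f = ∑ χ : Irr G, charPairing (χ : G → ℂ) f • (χ : G → ℂ) := by
  classical
  induction hf using Submodule.span_induction with
  | mem f h => simp [charPairing_Irr ⟨f, h⟩]
  | zero => simp
  | add f g _ _ hf hg =>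
    simp only [map_add, add_smul, Finset.sum_add_distrib]
    rw [← hf, ← hg]
  | smul c f _ hf =>
    simp only [map_smul, smul_assoc, ← Finset.smul_sum]
    rw [← hf]

end Orthogonality

/-! ### Permutation characters of quotients by normal subgroups -/

open Classical in
-- The average of `χ` over `N` is the dimension of the `N`-invariants. As `N` is normal these form a
-- subrepresentation, hence are zero or everything.
theorem sum_subgroup_Irr [Fintype G] (χ : Irr G) (N : Subgroup G) [N.Normal] :
    ∑ n : N, (χ : G → ℂ) n = if N ≤ charKer χ then Nat.card N * (χ : G → ℂ) 1 else 0 := by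
  have hirr := Irr.rep_isIrreducible χ
  have hN : (Nat.card N : ℂ) ≠ 0 := by exact_mod_cast Nat.card_pos.ne'
  have : Invertible (Nat.card N : ℂ) := invertibleOfNonzero hN
  have h := Representation.card_inv_mul_sum_char_eq_finrank ((Irr.rep χ).comp N.subtype)
  have h' : ∑ n : N, (χ : G → ℂ) n =
      Nat.card N * finrank ℂ (Representation.invariants ((Irr.rep χ).comp N.subtype)) := by
    rw [← h, mul_inv_cancel_left₀ hN]
    exact Finset.sum_congr rfl fun n _ => (congrFun (Irr.character_rep χ) n).symm
  let p : Subrepresentation (Irr.rep χ) :=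
    ⟨Representation.invariants ((Irr.rep χ).comp N.subtype),
      Representation.le_comap_invariants (Irr.rep χ) N⟩
  rw [h']
  split_ifs with hle
  · have : Representation.invariants ((Irr.rep χ).comp N.subtype) = ⊤ := by
      rw [eq_top_iff]
      intro v _ n
      have := hle n.2
      rw [charKer, MonoidHom.mem_ker] at this
      simp [this]
    rw [this, Irr.apply_one]
    simp
  · rcases hirr.eq_bot_or_eq_top p with hp | hp
    · have : Representation.invariants ((Irr.rep χ).comp N.subtype) = ⊥ :=
        congrArg Subrepresentation.toSubmodule hp
      rw [this]
      simp
    · refine absurd (fun n hn => ?_) hle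
      have : Representation.invariants ((Irr.rep χ).comp N.subtype) = ⊤ :=
        congrArg Subrepresentation.toSubmodule hp
      rw [charKer, MonoidHom.mem_ker]
      refine LinearMap.ext fun v => ?_
      have hv : v ∈ Representation.invariants ((Irr.rep χ).comp N.subtype) := by
        rw [this]; trivial
      exact hv ⟨n, hn⟩

/-- The indicator function of a subset of `G`. -/
def indic (P : Set G) : G → ℂ := P.indicator 1

/-- This function is the permutation character on `G ⧸ N`: an element of `N` fixes every coset, any
other element fixes none. -/
theorem index_smul_indic_mem_span [Finite G] (N : Subgroup G) [N.Normal] :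
    (N.index : ℂ) • indic (N : Set G) ∈ Submodule.span ℂ (Irr G) := by
  classical
  have := Fintype.ofFinite (G ⧸ N)
  let ρ : Representation ℂ G (G ⧸ N → ℂ) :=
    { toFun g := LinearMap.funLeft ℂ ℂ fun x => g⁻¹ • x
      map_one' := by ext; simp [LinearMap.funLeft]
      map_mul' g h := by
        ext f x
        simp [LinearMap.funLeft, mul_smul] }
  convert character_mem_span_Irr ρ using 1
  ext g
  rw [Representation.character, LinearMap.trace_eq_matrix_trace ℂ (Pi.basisFun ℂ (G ⧸ N)),
    Matrix.trace]
  have hdiag : ∀ x : G ⧸ N, (LinearMap.toMatrix (Pi.basisFun ℂ (G ⧸ N)) (Pi.basisFun ℂ (G ⧸ N))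
      (ρ g)).diag x = if g ∈ N then 1 else 0 := by
    intro x
    rw [Matrix.diag_apply, LinearMap.toMatrix_apply]
    have : (g⁻¹ • x = x) ↔ g ∈ N := by
      induction x using QuotientGroup.induction_on with
      | H a =>
        change ((g⁻¹ * a : G) : G ⧸ N) = a ↔ _
        rw [QuotientGroup.eq]
        have h1 : (g⁻¹ * a)⁻¹ * a = a⁻¹ * g * a⁻¹⁻¹ := by group
        rw [h1]
        exact ⟨fun h => by simpa [mul_assoc] using Subgroup.Normal.conj_mem ‹_› _ h a,
          fun h => Subgroup.Normal.conj_mem ‹_› _ h a⁻¹⟩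
    simp [ρ, LinearMap.funLeft, Pi.single_apply, this]
  simp only [hdiag, Finset.sum_const, Finset.card_univ]
  simp [indic, Set.indicator_apply, Subgroup.index_eq_card]

open Classical in
theorem index_smul_indic_eq_sum [Fintype G] (N : Subgroup G) [N.Normal] :
    (N.index : ℂ) • indic (N : Set G) =
      ∑ χ : Irr G with N ≤ charKer χ, (χ : G → ℂ) 1 • (χ : G → ℂ) := by
  rw [eq_sum_charPairing (index_smul_indic_mem_span N), Finset.sum_filter]
  refine Finset.sum_congr rfl fun χ _ => ?_
  have h1 : ∑ g : G, indic (N : Set G) g * (χ : G → ℂ) g⁻¹ = ∑ n : N, (χ : G → ℂ) n := by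
    rw [← Equiv.sum_comp (Equiv.inv N)]
    simp only [indic, Set.indicator_apply, ite_mul, zero_mul]
    rw [← Finset.sum_filter, ← Finset.sum_subtype_eq_sum_filter]
    simp
  have h2 : charPairing (χ : G → ℂ) ((N.index : ℂ) • indic (N : Set G)) =
      if N ≤ charKer χ then (χ : G → ℂ) 1 else 0 := by
    rw [map_smul, smul_eq_mul]
    rw [charPairing, LinearMap.coe_mk, AddHom.coe_mk, h1, sum_subgroup_Irr]
    have h3 : (Nat.card N : ℂ) * N.index = Nat.card G := by
      exact_mod_cast N.card_mul_index
    have h4 : (Nat.card G : ℂ) ≠ 0 := by exact_mod_cast Nat.card_pos.ne'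
    split_ifs
    · field_simp
      rw [← h3]; ring
    · simp
  rw [h2]
  split_ifs <;> simp

/-- Otherwise the permutation character of `G ⧸ N` would take the same value at `g` as at 1,
although it is 0 at `g` and the index at 1. -/
theorem exists_le_charKer_notMem [Fintype G] {N : Subgroup G} [N.Normal] {g : G} (hg : g ∉ N) :
    ∃ χ : Irr G, N ≤ charKer χ ∧ g ∉ charKer χ := by
  classical
  by_contra! hc
  have h := index_smul_indic_eq_sum N
  have hg' := congrFun h g
  have h1 := congrFun h 1
  simp only [indic, Finset.sum_apply, Pi.smul_apply, smul_eq_mul] at hg' h1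
  have : ∑ χ : Irr G with N ≤ charKer χ, (χ : G → ℂ) 1 * (χ : G → ℂ) g =
      ∑ χ : Irr G with N ≤ charKer χ, (χ : G → ℂ) 1 * (χ : G → ℂ) 1 :=
    Finset.sum_congr rfl fun χ hχ => by
      rw [mem_charKer.1 (hc χ (Finset.mem_filter.1 hχ).2)]
  rw [this, ← h1] at hg'
  simp [hg, N.one_mem] at hg'
  exact Subgroup.index_ne_zero_of_finite (by exact_mod_cast hg'.symm)

open Submodule

/-! ### Spans and dimensions -/

section LinearAlgebra

variable {M : Type*} [AddCommGroup M] [Module ℂ M]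

open Classical in
/-- Möbius inversion, at the level of spans. -/
theorem span_range_sum_le {P : Type*} [PartialOrder P] [Fintype P] (F : P → M) :
    span ℂ (Set.range fun N => ∑ L with L ≤ N, F L) = span ℂ (Set.range F) := by
  apply le_antisymm <;> rw [span_le] <;> rintro _ ⟨N, rfl⟩
  · exact sum_mem fun L _ => subset_span ⟨L, rfl⟩
  · induction N using WellFoundedLT.induction with
    | ind N ih =>
      have h : F N = (∑ L with L ≤ N, F L) - ∑ L with L < N, F L := by
        have : (Finset.univ.filter fun L => L ≤ N) =
            insert N (Finset.univ.filter fun L => L < N) := by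
          ext L
          simp [le_iff_eq_or_lt]
        rw [this, Finset.sum_insert (by simp), add_sub_cancel_right]
      rw [SetLike.mem_coe, h]
      exact sub_mem (subset_span ⟨N, rfl⟩)
        (sum_mem fun L hL => ih L (Finset.mem_filter.1 hL).2)

open Classical in
theorem span_range_sum_ge {P : Type*} [PartialOrder P] [Fintype P] (F : P → M) :
    span ℂ (Set.range fun N => ∑ L with N ≤ L, F L) = span ℂ (Set.range F) :=
  span_range_sum_le (P := Pᵒᵈ) F

theorem span_range_smul {ι : Type*} (c : ι → ℂ) (hc : ∀ i, c i ≠ 0) (v : ι → M) :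
    span ℂ (Set.range fun i => c i • v i) = span ℂ (Set.range v) := by
  apply le_antisymm <;> rw [span_le] <;> rintro _ ⟨i, rfl⟩
  · exact smul_mem _ _ (subset_span ⟨i, rfl⟩)
  · have := smul_mem _ (c i)⁻¹ (subset_span (R := ℂ) (s := Set.range fun i => c i • v i) ⟨i, rfl⟩)
    simpa [smul_smul, hc i] using this

theorem span_image_range_eq {α ι : Type*} (k : α → ι) (v : ι → M)
    (hv : ∀ i ∉ Set.range k, v i = 0) :
    span ℂ (v '' Set.range k) = span ℂ (Set.range v) := by
  refine le_antisymm (span_mono (Set.image_subset_range _ _)) ?_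
  rw [span_le]
  rintro _ ⟨i, rfl⟩
  by_cases hi : i ∈ Set.range k
  · exact subset_span ⟨i, hi, rfl⟩
  · rw [hv i hi]
    exact zero_mem _

/-- The functionals `φ a` separate the vectors indexed by the range of `k`, and the others vanish.
Applied both to fibre indicators and to supercharacters. -/
theorem finrank_span_range {α ι : Type*} [Finite ι] (k : α → ι) (v : ι → M) (φ : α → M →ₗ[ℂ] ℂ)
    (hv : ∀ i ∉ Set.range k, v i = 0) (hφ : ∀ a i, i ≠ k a → φ a (v i) = 0)
    (hφ' : ∀ a, φ a (v (k a)) ≠ 0) :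
    finrank ℂ (span ℂ (Set.range v)) = Nat.card (Set.range k) := by
  have := Fintype.ofFinite (Set.range k)
  have hli : LinearIndependent ℂ fun i : Set.range k => v i := by
    rw [Fintype.linearIndependent_iff]
    rintro c hc ⟨_, a, rfl⟩
    have h := congrArg (φ a) hc
    rw [map_sum, map_zero, Finset.sum_eq_single ⟨k a, a, rfl⟩] at h
    · simpa [hφ' a] using h
    · intro i _ hi
      rw [map_smul, hφ a i fun h => hi (Subtype.ext h), smul_zero]
    · simp
  rw [← span_image_range_eq k v hv, Set.image_eq_range, finrank_span_eq_card hli,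
    Nat.card_eq_fintype_card]

end LinearAlgebra

/-! ### Partitions into fibres -/

section Fibres

variable {α β : Type*}

/-- The partition of `α` into the nonempty fibres of `f`. -/
def fibres (f : α → β) : Set (Set α) := Set.range fun a => f ⁻¹' {f a}

theorem isPartition_fibres (f : α → β) : Setoid.IsPartition (fibres f) := by
  refine ⟨?_, fun a => ⟨f ⁻¹' {f a}, ⟨⟨a, rfl⟩, rfl⟩, ?_⟩⟩
  · rintro ⟨a, ha⟩
    exact Set.notMem_empty a (ha ▸ rfl : a ∈ (∅ : Set α))
  · rintro _ ⟨⟨b, rfl⟩, hb⟩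
    have : f a = f b := hb
    simp only [this]

theorem fibres_eq_image (f : α → β) : fibres f = (fun b => f ⁻¹' {b}) '' Set.range f := by
  rw [← Set.range_comp]
  rfl

theorem encard_fibres (f : α → β) : (fibres f).encard = (Set.range f).encard := by
  rw [fibres_eq_image]
  apply Set.InjOn.encard_image
  rintro _ ⟨a, rfl⟩ _ ⟨b, rfl⟩ h
  have : a ∈ f ⁻¹' {f b} := by
    rw [← show f ⁻¹' {f a} = f ⁻¹' {f b} from h]
    rfl
  exact this

end Fibres

/-! ### Normal closures and character kernels -/

/-- The type of normal subgroups. -/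
abbrev NormalSubgroup (G : Type*) [Group G] := {N : Subgroup G // N.Normal}

instance [Finite G] : Fintype (NormalSubgroup G) := Fintype.ofFinite _

/-- The normal subgroup generated by `g`. -/
def ncl (g : G) : NormalSubgroup G := ⟨Subgroup.normalClosure {g}, inferInstance⟩

theorem ncl_le_iff {g : G} {N : NormalSubgroup G} : ncl g ≤ N ↔ g ∈ N.1 := by
  have := N.2
  exact ⟨fun h => h (Subgroup.subset_normalClosure rfl),
    fun h => Subgroup.normalClosure_le_normal (by simpa using h)⟩

theorem ncl_eq_iff {g h : G} : ncl g = ncl h ↔ ∀ N : NormalSubgroup G, g ∈ N.1 ↔ h ∈ N.1 := by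
  simp only [← ncl_le_iff]
  exact ⟨fun e => by simp [e], fun e => le_antisymm ((e _).2 le_rfl) ((e _).1 le_rfl)⟩

/-- The kernel of an irreducible character as a normal subgroup. -/
def kerN (χ : Irr G) : NormalSubgroup G := ⟨charKer χ, inferInstance⟩

theorem ncl_eq_iff_charKer [Fintype G] {g h : G} :
    ncl g = ncl h ↔ ∀ χ : Irr G, g ∈ charKer χ ↔ h ∈ charKer χ := by
  refine ⟨fun e χ => ncl_eq_iff.1 e (kerN χ), fun e => ?_⟩
  have key : ∀ {a b : G}, (∀ χ : Irr G, a ∈ charKer χ → b ∈ charKer χ) → ncl b ≤ ncl a := by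
    intro a b hab
    rw [ncl_le_iff]
    by_contra hb
    have := (ncl a).2
    obtain ⟨χ, h1, h2⟩ := exists_le_charKer_notMem hb
    exact h2 (hab χ (h1 (ncl_le_iff.1 le_rfl)))
  exact le_antisymm (key fun χ => (e χ).2) (key fun χ => (e χ).1)

/-! ### Supercharacters and indicators of normal subgroups -/

section Indicators

open Classical in
theorem indic_eq_sum [Finite G] (N : NormalSubgroup G) :
    indic (N.1 : Set G) = ∑ L : NormalSubgroup G with L ≤ N, indic (ncl ⁻¹' {L}) := by
  ext g
  simp only [indic, Set.indicator_apply, Finset.sum_apply, Set.mem_preimage,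
    Set.mem_singleton_iff, Pi.one_apply]
  rw [Finset.sum_ite_eq]
  simp [ncl_le_iff]

theorem span_indic_fibres [Finite G] :
    span ℂ (Set.range fun N : NormalSubgroup G => indic (ncl ⁻¹' {N} : Set G)) =
      span ℂ (Set.range fun N : NormalSubgroup G => indic (N.1 : Set G)) := by
  classical
  rw [← span_range_sum_le]
  simp only [indic_eq_sum]

theorem indic_fibre_eq_zero {N : NormalSubgroup G} (hN : N ∉ Set.range (ncl (G := G))) :
    indic (ncl ⁻¹' {N} : Set G) = 0 := by
  have : (ncl ⁻¹' {N} : Set G) = ∅ := by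
    ext g
    simpa using fun h => hN ⟨g, h⟩
  ext g
  simp [indic, this]

variable [Fintype G]

open Classical in
/-- The supercharacter attached to the normal subgroup `N`. -/
def superchar (N : NormalSubgroup G) : G → ℂ :=
  ∑ χ : Irr G with kerN χ = N, (χ : G → ℂ) 1 • (χ : G → ℂ)

open Classical in
theorem index_smul_indic_eq_sum_superchar (N : NormalSubgroup G) :
    (N.1.index : ℂ) • indic (N.1 : Set G) = ∑ L : NormalSubgroup G with N ≤ L, superchar L := by
  have := N.2
  rw [index_smul_indic_eq_sum]
  simp only [superchar]
  rw [← Finset.sum_fiberwise_of_maps_to (t := Finset.univ.filter fun L => N ≤ L) (g := kerN)]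
  · refine Finset.sum_congr rfl fun L hL => Finset.sum_congr ?_ fun _ _ => rfl
    ext χ
    simp only [Finset.mem_filter, Finset.mem_univ, true_and, and_iff_right_iff_imp] at hL ⊢
    rintro rfl
    exact hL
  · intro χ hχ
    simpa using! hχ

theorem span_superchar :
    span ℂ (Set.range (superchar (G := G))) =
      span ℂ (Set.range fun N : NormalSubgroup G => indic (N.1 : Set G)) := by
  classical
  rw [← span_range_sum_ge]
  simp only [← index_smul_indic_eq_sum_superchar]
  exact span_range_smul _ (fun N => by exact_mod_cast Subgroup.index_ne_zero_of_finite) _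

theorem superchar_apply_eq (N : NormalSubgroup G) {a b : G} (h : ncl a = ncl b) :
    superchar N a = superchar N b := by
  have hN : superchar N ∈ span ℂ (Set.range fun N : NormalSubgroup G => indic (N.1 : Set G)) := by
    rw [← span_superchar]
    exact subset_span ⟨N, rfl⟩
  generalize superchar N = f at hN ⊢
  induction hN using span_induction with
  | mem f hf =>
    obtain ⟨N, rfl⟩ := hf
    classical
    simp [indic, Set.indicator_apply, ncl_eq_iff.1 h N]
  | zero => rfl
  | add f g _ _ hf hg => rw [Pi.add_apply, Pi.add_apply, hf, hg]
  | smul c f _ hf => rw [Pi.smul_apply, Pi.smul_apply, hf]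

/-- Both sides are the dimension of the span of the indicators of normal subgroups. The separating
functionals are evaluation at `g` and pairing with `χ`. -/
theorem card_range_ncl :
    Nat.card (Set.range (ncl (G := G))) = Nat.card (Set.range (kerN (G := G))) := by
  classical
  rw [← finrank_span_range ncl (fun N : NormalSubgroup G => indic (ncl ⁻¹' {N} : Set G))
      (fun g => LinearMap.proj g) (fun N hN => indic_fibre_eq_zero hN),
    ← finrank_span_range kerN (superchar (G := G)) (fun χ => charPairing (χ : G → ℂ)),
    span_superchar, span_indic_fibres]
  · intro N hN
    rw [superchar, Finset.sum_eq_zero]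
    intro χ hχ
    exact absurd ⟨χ, (Finset.mem_filter.1 hχ).2⟩ hN
  · intro χ N hN
    simp [superchar, charPairing_Irr, hN.symm]
  · intro χ
    simp [superchar, charPairing_Irr, Irr.apply_one_ne_zero]
  · intro g N hN
    simp [indic, hN.symm]
  · intro g
    simp [indic]

end Indicators

theorem isSupercharacterTheory_fibres [Fintype G] :
    IsSupercharacterTheory (fibres (kerN (G := G))) (fibres (ncl (G := G))) where
  partition_irr := isPartition_fibres _
  partition_group := isPartition_fibres _
  card_eq := by
    rw [encard_fibres, encard_fibres, ← (Set.toFinite _).cast_ncard_eq,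
      ← (Set.toFinite (Set.range kerN)).cast_ncard_eq]
    exact congrArg _ card_range_ncl
  supercharacter := by
    classical
    rintro _ ⟨χ, rfl⟩
    -- Multiplicity `ψ(1)` on the characters with the same kernel as `χ` gives `superchar (kerN χ)`.
    refine ⟨Finsupp.equivFunOnFinite.symm fun ψ => if kerN ψ = kerN χ then Irr.degree ψ else 0,
      fun h => ?_, fun ψ hψ => ?_, ?_⟩
    · have := DFunLike.congr_fun h χ
      simp [Irr.degree_ne_zero] at this
    · by_contra hne
      have : kerN ψ ≠ kerN χ := hne
      simp [this] at hψ
    · rintro _ ⟨g, rfl⟩ a ha b hb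
      have hs : charOfMult (Finsupp.equivFunOnFinite.symm
          fun ψ : Irr G => if kerN ψ = kerN χ then Irr.degree ψ else 0) = superchar (kerN χ) := by
        ext x
        rw [charOfMult, Finsupp.sum_fintype _ _ (by simp), superchar, Finset.sum_filter,
          Finset.sum_apply]
        refine Finset.sum_congr rfl fun ψ _ => ?_
        split_ifs with h <;> simp [h, Irr.apply_one]
      rw [hs]
      exact superchar_apply_eq _ (Eq.trans ha (Eq.symm hb))
  singleton_one := by
    refine ⟨1, ?_⟩
    ext g
    simp only [Set.mem_preimage, Set.mem_singleton_iff]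
    refine ⟨fun h => ?_, fun h => by rw [h]⟩
    have := ncl_eq_iff.1 h ⟨⊥, inferInstance⟩
    simpa using this

/-! ### The subring condition in the group algebra -/

section GroupAlgebra

open MonoidAlgebra

open scoped Classical

variable [Fintype G]

/-- A function on `G` as an element of the group algebra. -/
def toAlg : (G → ℂ) →ₗ[ℂ] MonoidAlgebra ℂ G where
  toFun f := ∑ g, single g (f g)
  map_add' f g := by simp [single_add, Finset.sum_add_distrib]
  map_smul' c f := by simp [Finset.smul_sum]

omit [Group G] in
theorem toAlg_injective : Function.Injective (toAlg (G := G)) := by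
  intro f f' h
  ext g
  have := congrArg (fun x => x.coeff g) h
  simpa [toAlg, Finsupp.single_apply] using this

theorem setSum_eq_toAlg (P : Set G) : setSum P = toAlg (indic P) := by
  simp only [setSum, toAlg, LinearMap.coe_mk, AddHom.coe_mk, indic, Set.indicator_apply]
  rw [← Finset.sum_filter_add_sum_filter_not Finset.univ (· ∈ P)]
  rw [Finset.sum_congr (s₁ := P.toFinite.toFinset) (s₂ := Finset.univ.filter (· ∈ P))
    (by ext; simp) fun _ _ => rfl, Finset.sum_eq_zero (s := Finset.univ.filter (· ∉ P)), add_zero]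
  · refine Finset.sum_congr rfl fun g hg => ?_
    simp [(Finset.mem_filter.1 hg).2]
  · intro g hg
    simp [(Finset.mem_filter.1 hg).2]

theorem setSum_subgroup (H : Subgroup G) : setSum (H : Set G) = ∑ h : H, single (h : G) (1 : ℂ) := by
  rw [setSum, ← Finset.sum_coe_sort]
  exact Fintype.sum_equiv (Equiv.subtypeEquivRight fun g => by simp) _ _ fun _ => rfl

theorem single_mul_setSum {H : Subgroup G} {g : G} (hg : g ∈ H) :
    single g 1 * setSum (H : Set G) = setSum (H : Set G) := by
  rw [setSum_subgroup, Finset.mul_sum]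
  exact Fintype.sum_equiv (Equiv.mulLeft ⟨g, hg⟩) _ _ fun h => by simp [single_mul_single]

theorem setSum_mul_single {H : Subgroup G} {g : G} (hg : g ∈ H) :
    setSum (H : Set G) * single g 1 = setSum (H : Set G) := by
  rw [setSum_subgroup, Finset.sum_mul]
  exact Fintype.sum_equiv (Equiv.mulRight ⟨g, hg⟩) _ _ fun h => by simp [single_mul_single]

theorem setSum_mem_center (N : Subgroup G) [N.Normal] :
    setSum (N : Set G) ∈ Subalgebra.center ℂ (MonoidAlgebra ℂ G) := by
  rw [Subalgebra.mem_center_iff]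
  intro x
  induction x using MonoidAlgebra.induction_linear with
  | zero => simp
  | add x y hx hy => rw [add_mul, mul_add, hx, hy]
  | single g c =>
    rw [setSum_subgroup, Finset.mul_sum, Finset.sum_mul]
    refine Fintype.sum_equiv (MulAut.conjNormal g).toEquiv _ _ fun n => ?_
    simp [single_mul_single]

theorem setSum_mul_eq_smul {H L : Subgroup G} (h : H ≤ L) :
    setSum (L : Set G) * setSum (H : Set G) = (Nat.card H : ℂ) • setSum (L : Set G) := by
  rw [setSum_subgroup H, Finset.mul_sum,
    Finset.sum_congr rfl fun n _ => setSum_mul_single (h n.2)]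
  simp [Nat.cast_smul_eq_nsmul]

/-- The product on the left absorbs left multiplication by `N` and, by centrality, by `M`, hence by
`N ⊔ M`. Multiplying it by the sum over `N ⊔ M` and evaluating in two ways gives the scalar. -/
theorem setSum_mul_setSum (N M : Subgroup G) [N.Normal] [M.Normal] :
    setSum (N : Set G) * setSum (M : Set G) =
      ((Nat.card (N ⊔ M : Subgroup G) : ℂ)⁻¹ * (Nat.card N * Nat.card M)) •
        setSum ((N ⊔ M : Subgroup G) : Set G) := by
  have hinv : ∀ g ∈ N ⊔ M, single g 1 * (setSum (N : Set G) * setSum (M : Set G)) =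
      setSum (N : Set G) * setSum (M : Set G) := by
    let S : Subgroup G :=
      { carrier := {g | single g 1 * (setSum (N : Set G) * setSum (M : Set G)) =
          setSum (N : Set G) * setSum (M : Set G)}
        one_mem' := by simp [← one_def]
        mul_mem' := fun {a b} ha hb => by
          simp only [Set.mem_ofPred_eq] at ha hb ⊢
          rw [← mul_one (1 : ℂ), ← single_mul_single, mul_assoc, hb, ha]
        inv_mem' := fun {a} ha => by
          simp only [Set.mem_ofPred_eq] at ha ⊢
          nth_rewrite 1 [← ha]
          rw [← mul_assoc, single_mul_single]
          simp [← one_def] }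
    have hN : N ≤ S := fun n hn => by
      change _ = _
      rw [← mul_assoc, single_mul_setSum hn]
    have hM : M ≤ S := fun m hm => by
      change _ = _
      rw [Subalgebra.mem_center_iff.1 (setSum_mem_center M), ← mul_assoc, single_mul_setSum hm]
    exact fun g hg => sup_le hN hM hg
  have h1 : setSum ((N ⊔ M : Subgroup G) : Set G) * (setSum (N : Set G) * setSum (M : Set G)) =
      (Nat.card (N ⊔ M : Subgroup G) : ℂ) • (setSum (N : Set G) * setSum (M : Set G)) := by
    rw [setSum_subgroup (N ⊔ M), Finset.sum_mul, Fintype.sum_congr _ _ fun n : (N ⊔ M : Subgroup G) => hinv n n.2]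
    simp [Nat.cast_smul_eq_nsmul]
  have h2 : setSum ((N ⊔ M : Subgroup G) : Set G) * (setSum (N : Set G) * setSum (M : Set G)) =
      ((Nat.card N : ℂ) * Nat.card M) • setSum ((N ⊔ M : Subgroup G) : Set G) := by
    rw [← mul_assoc, setSum_mul_eq_smul le_sup_left, smul_mul_assoc,
      setSum_mul_eq_smul le_sup_right, smul_smul]
  have hne : (Nat.card (N ⊔ M : Subgroup G) : ℂ) ≠ 0 := by exact_mod_cast Nat.card_pos.ne'
  rw [mul_smul, ← h2, h1, smul_smul, inv_mul_cancel₀ hne, one_smul]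

theorem span_setSum_fibres :
    span ℂ (setSum '' fibres (ncl (G := G))) =
      span ℂ (Set.range fun N : NormalSubgroup G => setSum (N.1 : Set G)) := by
  rw [fibres_eq_image, Set.image_image, span_image_range_eq]
  · have h := congrArg (Submodule.map (toAlg (G := G))) span_indic_fibres
    rw [Submodule.map_span, Submodule.map_span, ← Set.range_comp, ← Set.range_comp] at h
    simpa only [Function.comp_def, ← setSum_eq_toAlg] using h
  · intro N hN
    rw [setSum_eq_toAlg, indic_fibre_eq_zero hN, map_zero]

/-- The algebra spanned by the sums of normal subgroups. -/
def normalSumAlgebra (G : Type*) [Group G] [Fintype G] : Subalgebra ℂ (MonoidAlgebra ℂ G) :=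
  (span ℂ (Set.range fun N : NormalSubgroup G => setSum (N.1 : Set G))).toSubalgebra
    (subset_span ⟨⟨⊥, inferInstance⟩, by
      simp only [setSum_subgroup, Fintype.sum_unique]
      rfl⟩)
    fun x y hx hy => by
      have := Submodule.mul_mem_mul hx hy
      rw [Submodule.span_mul_span] at this
      refine span_le.2 ?_ this
      rintro _ ⟨_, ⟨N, rfl⟩, _, ⟨M, rfl⟩, rfl⟩
      have := N.2
      have := M.2
      simp only [setSum_mul_setSum, SetLike.mem_coe]
      exact smul_mem _ _ (subset_span ⟨⟨N.1 ⊔ M.1, inferInstance⟩, rfl⟩)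

theorem normalSumAlgebra_le_center : normalSumAlgebra G ≤ Subalgebra.center ℂ _ := by
  have : span ℂ (Set.range fun N : NormalSubgroup G => setSum (N.1 : Set G)) ≤
      Subalgebra.toSubmodule (Subalgebra.center ℂ _) := by
    rw [span_le]
    rintro _ ⟨N, rfl⟩
    have := N.2
    exact setSum_mem_center N.1
  exact this

end GroupAlgebra

theorem isSuperclassTheory_fibres [Fintype G] : IsSuperclassTheory (fibres (ncl (G := G))) where
  partition := isPartition_fibres _
  superclasses := ⟨_, isSupercharacterTheory_fibres⟩
  singleton_one := isSupercharacterTheory_fibres.singleton_one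
  subring := ⟨(normalSumAlgebra G).toSubring, normalSumAlgebra_le_center, by
    rw [span_setSum_fibres]
    rfl⟩

/-! ### Identification of the sets `K g` -/

section Idempotents

variable [Fintype G]

theorem centralIdem_injective {χ ψ : Irr G}
    (h : centralIdem (χ : G → ℂ) = centralIdem (ψ : G → ℂ)) : χ = ψ := by
  have hT : ∀ χ : G → ℂ, centralIdem χ =
      ((Fintype.card G : ℂ)⁻¹ * χ 1) • toAlg fun g => χ g⁻¹ := fun _ => rfl
  rw [hT, hT, ← map_smul, ← map_smul] at h
  have hc : (Fintype.card G : ℂ)⁻¹ ≠ 0 := inv_ne_zero (by exact_mod_cast Fintype.card_ne_zero)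
  have h1 : ∀ g, (χ : G → ℂ) 1 * (χ : G → ℂ) g = (ψ : G → ℂ) 1 * (ψ : G → ℂ) g := fun g => by
    have := congrFun (toAlg_injective h) g⁻¹
    simpa only [Pi.smul_apply, inv_inv, smul_eq_mul, mul_assoc, mul_right_inj' hc] using this
  -- At 1 the relation equates squares of degrees, which are natural numbers.
  have h2 : (χ : G → ℂ) 1 = (ψ : G → ℂ) 1 := by
    have := h1 1
    simp only [Irr.apply_one] at this ⊢
    norm_cast at this ⊢
    exact Nat.mul_self_inj.1 this
  refine Subtype.ext (funext fun g => mul_left_cancel₀ (Irr.apply_one_ne_zero χ) ?_)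
  rw [h1, h2]

theorem one_sub_div_ne_zero_iff (χ : Irr G) (g : G) :
    1 - (χ : G → ℂ) g / (χ : G → ℂ) 1 ≠ 0 ↔ g ∉ charKer χ := by
  rw [mem_charKer, not_iff_not, sub_eq_zero, eq_comm, div_eq_one_iff_eq (Irr.apply_one_ne_zero χ)]

theorem centralIdem_mem_E (χ : Irr G) (g : G) :
    centralIdem (χ : G → ℂ) ∈ E g ↔ g ∉ charKer χ := by
  rw [← one_sub_div_ne_zero_iff]
  refine ⟨?_, fun h => ⟨χ, χ.2, h, rfl⟩⟩
  rintro ⟨ψ, hψ, h, e⟩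
  obtain rfl : χ = ⟨ψ, hψ⟩ := centralIdem_injective e
  exact h

theorem E_eq_iff {g h : G} : E g = E h ↔ ncl g = ncl h := by
  rw [ncl_eq_iff_charKer]
  constructor
  · intro e χ
    rw [← not_iff_not, ← centralIdem_mem_E, ← centralIdem_mem_E, e]
  · intro e
    ext x
    refine exists_congr fun χ => and_congr_right fun hχ => and_congr_left fun _ => ?_
    rw [one_sub_div_ne_zero_iff ⟨χ, hχ⟩, one_sub_div_ne_zero_iff ⟨χ, hχ⟩, e]

theorem K_eq (g : G) : K g = ncl ⁻¹' {ncl g} := by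
  ext h
  simp only [K, Set.mem_iUnion, exists_prop, Set.mem_preimage, Set.mem_singleton_iff, E_eq_iff]
  constructor
  · rintro ⟨k, e, hk⟩
    rw [e, ncl_eq_iff]
    obtain ⟨c, rfl⟩ := isConj_iff.1 (show IsConj k h from hk)
    intro N
    exact ⟨fun h => by simpa [mul_assoc] using N.2.conj_mem _ h c⁻¹, fun h => N.2.conj_mem _ h c⟩
  · intro e
    exact ⟨h, e.symm, mem_conjugatesOf_self⟩

theorem range_K : Set.range (K (G := G)) = fibres ncl := by
  rw [funext (K_eq (G := G))]
  rfl

theorem mem_K_iff {g h : G} : h ∈ K g ↔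
    ∀ χ ∈ Irr G, (1 - χ h / χ 1 ≠ 0 ↔ 1 - χ g / χ 1 ≠ 0) := by
  rw [K_eq, Set.mem_preimage, Set.mem_singleton_iff, ncl_eq_iff_charKer]
  refine ⟨fun e χ hχ => ?_, fun e χ => ?_⟩
  · rw [one_sub_div_ne_zero_iff ⟨χ, hχ⟩, one_sub_div_ne_zero_iff ⟨χ, hχ⟩, e]
  · rw [← not_iff_not, ← one_sub_div_ne_zero_iff, ← one_sub_div_ne_zero_iff]
    exact e χ χ.2

end Idempotents

/-! ### The sets `N°` and comparison with other normal theories -/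

theorem circ_normalSubgroups (N : NormalSubgroup G) :
    circ (normalSubgroups G) N.1 = ncl ⁻¹' {N} := by
  ext g
  simp only [circ, Set.mem_sdiff, SetLike.mem_coe, Set.mem_iUnion, exists_prop, not_exists,
    not_and, Set.mem_preimage, Set.mem_singleton_iff]
  constructor
  · rintro ⟨h1, h2⟩
    by_contra hne
    exact h2 _ (ncl g).2 (lt_of_le_of_ne (ncl_le_iff.2 h1) fun h => hne (Subtype.ext h)) (ncl_le_iff.1 le_rfl)
  · rintro rfl
    exact ⟨ncl_le_iff.1 le_rfl, fun H hH hlt hg =>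
      hlt.not_ge (ncl_le_iff (N := ⟨H, hH⟩).2 hg)⟩

theorem circParts_normalSubgroups : circParts (normalSubgroups G) = fibres ncl := by
  ext P
  constructor
  · rintro ⟨⟨g, hg⟩, N, hN, rfl⟩
    rw [circ_normalSubgroups ⟨N, hN⟩] at hg ⊢
    have e : ncl g = ⟨N, hN⟩ := hg
    exact ⟨g, congrArg (fun L => ncl ⁻¹' {L}) e⟩
  · rintro ⟨g, rfl⟩
    exact ⟨⟨g, rfl⟩, _, (ncl g).2, (circ_normalSubgroups _).symm⟩

theorem Generated.normal {S : Set (Subgroup G)} (hS : S ⊆ normalSubgroups G) {N : Subgroup G}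
    (h : Generated S N) : N.Normal := by
  induction h with
  | basic N hN => exact hS hN
  | bot => infer_instance
  | top => infer_instance
  | mul H K _ _ h1 h2 => infer_instance
  | inter H K _ _ h1 h2 => infer_instance

theorem generated_normalSubgroups :
    {N | Generated (normalSubgroups G) N} = normalSubgroups G :=
  Set.ext fun N => ⟨Generated.normal subset_rfl, Generated.basic N⟩

theorem refines_of_isNormalTheory [Finite G] {𝒦 : Set (Set G)} (h : IsNormalTheory 𝒦) :
    Refines (fibres ncl) 𝒦 := by
  obtain ⟨S, hS, rfl⟩ := h
  rintro _ ⟨g, rfl⟩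
  -- By minimality `g` lies in `N°`. Elements with the same normal closure lie in the same normal
  -- subgroups, so the whole fibre follows.
  obtain ⟨N, ⟨hN, hgN⟩, hmin⟩ := (Set.toFinite {N | Generated S N ∧ g ∈ N}).exists_minimal
    ⟨⊤, Generated.top, trivial⟩
  have hsub : ncl ⁻¹' {ncl g} ⊆ circ {N | Generated S N} N := by
    intro h hh
    have e := ncl_eq_iff.1 (show ncl h = ncl g from hh)
    refine ⟨(e ⟨N, hN.normal hS⟩).2 hgN, ?_⟩
    simp only [Set.mem_iUnion, not_exists]
    intro H hH hlt hmem
    exact hlt.not_ge (hmin ⟨hH, (e ⟨H, Generated.normal hS hH⟩).1 hmem⟩ hlt.le)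
  exact ⟨_, ⟨⟨g, hsub rfl⟩, N, hN, rfl⟩, hsub⟩

end NormalSCT

end

theorem mainTheorem3 {G : Type*} [Group G] [Fintype G] :
    -- the sets `K_g` are exactly the nonempty `N°`, for `N` a normal subgroup
    Set.range (NormalSCT.K (G := G)) = NormalSCT.circParts (NormalSCT.normalSubgroups G) ∧
    -- they form the theory generated by the set of all normal subgroups
    NormalSCT.circParts (NormalSCT.normalSubgroups G) =
      NormalSCT.circParts {N | NormalSCT.Generated (NormalSCT.normalSubgroups G) N} ∧
    -- they form a superclass theory
    NormalSCT.IsSuperclassTheory (Set.range (NormalSCT.K (G := G))) ∧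
    -- which is the finest normal one
    NormalSCT.IsNormalTheory (Set.range (NormalSCT.K (G := G))) ∧
    (∀ 𝒦 : Set (Set G), NormalSCT.IsNormalTheory 𝒦 →
      NormalSCT.Refines (Set.range (NormalSCT.K (G := G))) 𝒦) ∧
    -- and it is determined by the (non)vanishing of the values `1 - χ(g)/χ(1)`
    (∀ g h : G, h ∈ NormalSCT.K g ↔
      ∀ χ ∈ NormalSCT.Irr G, (1 - χ h / χ 1 ≠ 0 ↔ 1 - χ g / χ 1 ≠ 0)) := by
  have h := (NormalSCT.range_K (G := G)).trans NormalSCT.circParts_normalSubgroups.symm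
  have hgen : NormalSCT.circParts (NormalSCT.normalSubgroups G) =
      NormalSCT.circParts {N | NormalSCT.Generated (NormalSCT.normalSubgroups G) N} := by
    rw [NormalSCT.generated_normalSubgroups]
  refine ⟨h, hgen, ?_, ⟨_, subset_rfl, h.trans hgen⟩, ?_, fun g h => NormalSCT.mem_K_iff⟩
  · rw [NormalSCT.range_K]
    exact NormalSCT.isSuperclassTheory_fibres
  · intro 𝒦 h𝒦
    rw [NormalSCT.range_K]
    exact NormalSCT.refines_of_isNormalTheory h𝒦
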